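/- For $n\ge 1$ and $\lambda=(\lambda_1,\dots,\lambda_n)\in\mathbb R^n$ put $g(i,j,k)=\lambda_i+\lambda_j+\lambda_k$, and let ${\bf G}^+=[g_+(i,j,k)]$ be the $n\times n\times n$ tensor with $g_+(1,1,1)=0$ and $g_+(i,j,k)=1/g(i,j,k)$ for $(i,j,k)\neq(1,1,1)$ (these entries are defined under the condition $(*)$ below). A tensor has canonical rank at most $r$ if it has the form $\sum_{m=1}^{r}u^{(m)}\otimes v^{(m)}\otimes w^{(m)}$ with $u^{(m)},v^{(m)},w^{(m)}\in\mathbb R^n$. Let $a>0$ and $b\in\mathbb R$. Then there is a function $R:(0,\infty)\to\mathbb N$, depending only on $a$ and $b$ (not on $n$ or $\lambda$), with $R(\varepsilon)=O(|\log\varepsilon|)$ as $\varepsilon\to0$, such that for every $\varepsilon>0$ the following holds. (1) For every $n\ge1$ and every $\lambda\in\mathbb R^n$ with $$(*)\qquad \lambda_i+\lambda_j+\lambda_k\ge a\quad\text{for all }(i,j,k)\ne(1,1,1),$$ and $\lambda_i\le b$ for all $i$: (i) there is a tensor $T$ of canonical rank at most $R(\varepsilon)$ with $|1/g(i,j,k)-T(i,j,k)|\le\varepsilon$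 for all $(i,j,k)$ with $g(i,j,k)\ne0$, that is, for all entries of $[1/g]$ that are defined; (ii) there is a tensor $T'$ of canonical rank at most $2R(\varepsilon)+1$ with $|g_+(i,j,k)-T'(i,j,k)|\le2\varepsilon$ for all $(i,j,k)$. (2) Let $n\ge3$, let $\Delta_P\in\mathbb R^{n\times n}$ be the circulant matrix with first column $p=(2,-1,0,\dots,0,-1)^T$, let $F=n^{-1/2}\big[e^{-2\pi\mathrm i (j-1)(k-1)/n}\big]_{j,k=1}^n$ be the unitary Fourier matrix, and let $\lambda_j=\sum_{k}p_k e^{-2\pi \mathrm i(j-1)(k-1)/n}$, $j=1,\dots,n$, be the eigenvalues of $\Delta_P$. If $a\le 4\sin^2(\pi/n)$ and $b\ge4$, then $\lambda$ satisfies $(*)$, and the Moore–Penrose pseudo-inverse $A_\Delta^+$ of the periodic Laplacian $A_\Delta=\Delta_P\otimes I\otimes I+I\otimes\Delta_P\otimes I+I\otimes I\otimes\Delta_P$ has an approximation of Kronecker rank at most $2R(\varepsilon)+1$: there are $u^{(m)},v^{(m)},w^{(m)}\in\mathbb R^n$ with $$\Big\|A_\Delta^+-\sum_{m=1}^{2R(\varepsilon)+1}\big(F^*\mathrm{diag}(u^{(m)})F\big)\otimes\big(F^*\mathrm{diag}(v^{(m)})F\big)\otimes\big(F^*\mathrm{diag}(w^{(m)})F\big)\Big\|\le2\varepsilon$$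 in the spectral norm. -/

import Mathlib

open Filter Topology Asymptotics
open scoped Kronecker Matrix Matrix.Norms.L2Operator

noncomputable section

namespace PeriodicLaplacian

/-- `T` has a canonical decomposition with `r` terms, i.e. canonical rank at most `r`:
`T = ∑_{m=1}^r u^{(m)} ⊗ v^{(m)} ⊗ w^{(m)}`. -/
def HasCanonicalDecomposition {n : ℕ} (r : ℕ) (T : Fin n → Fin n → Fin n → ℝ) : Prop :=
  ∃ u v w : Fin r → Fin n → ℝ, ∀ i j k, T i j k = ∑ m, u m i * v m j * w m k

/-- The core tensor `g(i,j,k) = λ_i + λ_j + λ_k`. -/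
def coreTensor {n : ℕ} (lam : Fin n → ℝ) (i j k : Fin n) : ℝ := lam i + lam j + lam k

/-- The pseudo-inverse core tensor: the first entry is zero, the others are `1 / g(i,j,k)`.
The mathematical index `1` is the index `0` of `Fin n`. -/
def pinvCoreTensor {n : ℕ} [NeZero n] (lam : Fin n → ℝ) (i j k : Fin n) : ℝ :=
  if i = 0 ∧ j = 0 ∧ k = 0 then 0 else 1 / coreTensor lam i j k

/-- `λ_i + λ_j + λ_k ≥ a` for all index triples other than the first one. -/
def PositivityCondition {n : ℕ} [NeZero n] (a : ℝ) (lam : Fin n → ℝ) : Prop :=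
  ∀ i j k : Fin n, ¬(i = 0 ∧ j = 0 ∧ k = 0) → a ≤ coreTensor lam i j k

/-- The vector `p = (2, -1, 0, …, 0, -1)` (for `n ≥ 3`). -/
def stencil (n : ℕ) [NeZero n] : Fin n → ℝ := fun j =>
  if j = 0 then 2 else if j.val = 1 ∨ j.val + 1 = n then -1 else 0

/-- The periodic one-dimensional Laplacian: the circulant matrix with first column `p`. -/
def laplacian1D (n : ℕ) [NeZero n] : Matrix (Fin n) (Fin n) ℂ :=
  Matrix.circulant fun j => (stencil n j : ℂ)

/-- The periodic three-dimensional Laplacian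
`A ⊗ I ⊗ I + I ⊗ A ⊗ I + I ⊗ I ⊗ A`. -/
def laplacian3D (n : ℕ) [NeZero n] :
    Matrix (Fin n × Fin n × Fin n) (Fin n × Fin n × Fin n) ℂ :=
  laplacian1D n ⊗ₖ ((1 : Matrix (Fin n) (Fin n) ℂ) ⊗ₖ (1 : Matrix (Fin n) (Fin n) ℂ))
    + (1 : Matrix (Fin n) (Fin n) ℂ) ⊗ₖ (laplacian1D n ⊗ₖ (1 : Matrix (Fin n) (Fin n) ℂ))
    + (1 : Matrix (Fin n) (Fin n) ℂ) ⊗ₖ ((1 : Matrix (Fin n) (Fin n) ℂ) ⊗ₖ laplacian1D n)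

/-- The eigenvalues of the periodic one-dimensional Laplacian: the discrete Fourier transform
of `p`, whose values are real because `p` is real and even. -/
def laplacianEigenvalue (n : ℕ) [NeZero n] (j : Fin n) : ℝ :=
  (∑ k : Fin n, (stencil n k : ℂ) *
    Complex.exp (-(2 * Real.pi * Complex.I * ((j.val : ℂ) * (k.val : ℂ)) / (n : ℂ)))).re

/-- The unitary discrete Fourier transform matrix. -/
def fourierMatrix (n : ℕ) : Matrix (Fin n) (Fin n) ℂ := Matrix.of fun j k =>
  ((Real.sqrt n : ℝ) : ℂ)⁻¹ *
    Complex.exp (-(2 * Real.pi * Complex.I * ((j.val : ℂ) * (k.val : ℂ)) / (n : ℂ)))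

/-- The matrix `F^* diag(u) F`. -/
def fourierDiagonal {n : ℕ} (u : Fin n → ℝ) : Matrix (Fin n) (Fin n) ℂ :=
  (fourierMatrix n)ᴴ * Matrix.diagonal (fun i => (u i : ℂ)) * fourierMatrix n

/-- `X` is the Moore-Penrose pseudo-inverse of `A` (the four Penrose equations). -/
def IsPseudoInverse {ι : Type*} [Fintype ι] (A X : Matrix ι ι ℂ) : Prop :=
  A * X * A = A ∧ X * A * X = X ∧ (A * X)ᴴ = A * X ∧ (X * A)ᴴ = X * A

end PeriodicLaplacian

end

/-! Put `z = exp (-x)`, so that `1 / x = -1 / log z`. This function is holomorphic on the disc of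
radius `1/2` about `1/2`, and for `0 < a` the image of `[a, 3b]` is a compact subset of `(0, 1)`.
The Taylor polynomials at `1/2` therefore converge geometrically there (`exists_expSum_approx_inv`).
A polynomial in `exp (-g)` separates, since `exp (-m g)` is a product of functions of `i`, `j` and
`k`: `N` terms give rank `N`, and `N = O(|log ε|)` suffices. One rank-one term repairs the first
entry (`exists_canonical_approx`). For the Laplacian, the Fourier matrix diagonalizes everything,
and unitary invariance turns the spectral error into the largest entrywise error
(`norm_fourierDiagonal3D_le`). -/

noncomputable section

namespace PeriodicLaplacian

/-! ### Exponential sums for `1 / x`. -/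

section ExponentialSums

/-- Every partial sum of a one-variable power series is a polynomial in the shifted variable. -/
theorem exists_polynomial_eq_partialSum (p : FormalMultilinearSeries ℂ ℂ ℂ) (z₀ : ℂ) (N : ℕ) :
    ∃ P : Polynomial ℂ, P.degree < N ∧ ∀ z, P.eval z = p.partialSum N (z - z₀) := by
  refine ⟨∑ m ∈ Finset.range N, Polynomial.C (p.coeff m) * (Polynomial.X - Polynomial.C z₀) ^ m,
    ?_, ?_⟩
  · rw [Polynomial.degree_lt_iff_coeff_zero]
    intro k hk
    rw [Polynomial.finsetSum_coeff]
    refine Finset.sum_eq_zero fun m hm => ?_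
    have hm' := Finset.mem_range.1 hm
    rw [Polynomial.coeff_C_mul, Polynomial.coeff_eq_zero_of_natDegree_lt, mul_zero]
    refine lt_of_le_of_lt Polynomial.natDegree_pow_le ?_
    rw [Polynomial.natDegree_X_sub_C]
    omega
  · intro z
    simp [Polynomial.eval_finsetSum, FormalMultilinearSeries.partialSum, mul_comm]

/-- The function `z ↦ -1 / log z` is holomorphic on every disc around `1/2` of radius less
than `1/2`. -/
theorem differentiableOn_neg_inv_log {r : ℝ} (hr : r < 1 / 2) :
    DifferentiableOn ℂ (fun z => -(Complex.log z)⁻¹) (Metric.closedBall (1 / 2) r) := by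
  intro z hz
  have hz' : ‖z - 1 / 2‖ < 1 / 2 := by
    rw [Metric.mem_closedBall, dist_eq_norm] at hz
    linarith
  have hre := (Complex.abs_re_le_norm (z - 1 / 2)).trans_lt hz'
  rw [Complex.sub_re, show (1 / 2 : ℂ).re = 1 / 2 by norm_num, abs_lt] at hre
  have hslit : z ∈ Complex.slitPlane := Or.inl (by linarith)
  have hlog : Complex.log z ≠ 0 := by
    intro h
    have hz1 : z = 1 := by
      rw [← Complex.exp_log (Complex.slitPlane_ne_zero hslit), h, Complex.exp_zero]
    rw [hz1, Complex.one_re] at hre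
    linarith
  exact ((differentiableAt_id.clog hslit).inv hlog).neg.differentiableWithinAt

/-- Exponential sums approximate `1 / x` on `[a, B]` at a geometric rate. -/
theorem exists_expSum_approx_inv {a B : ℝ} (ha : 0 < a) :
    ∃ C > 0, ∃ ρ ∈ Set.Ioo (0 : ℝ) 1, ∀ N : ℕ, ∃ c : Fin N → ℝ, ∀ x ∈ Set.Icc a B,
      |1 / x - ∑ m, c m * Real.exp (-x) ^ (m : ℕ)| ≤ C * ρ ^ N := by
  obtain ⟨s, hs0, hs, hsI⟩ : ∃ s : ℝ, 0 ≤ s ∧ s < 1 / 2 ∧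
      ∀ x ∈ Set.Icc a B, |Real.exp (-x) - 1 / 2| ≤ s := by
    have hea : Real.exp (-a) < 1 := by simpa using ha
    -- The outer `max 0` only matters when `B < a`, where the interval is empty.
    refine ⟨max 0 (max (Real.exp (-a) - 1 / 2) (1 / 2 - Real.exp (-B))), le_max_left _ _, ?_,
      fun x hx => ?_⟩
    · have := Real.exp_pos (-B)
      refine max_lt (by norm_num) (max_lt (by linarith) (by linarith))
    · refine le_max_of_le_right (abs_le.2 ⟨?_, le_max_of_le_left ?_⟩)
      · rw [neg_le]
        refine le_max_of_le_right ?_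
        have := Real.exp_le_exp.2 (neg_le_neg hx.2)
        linarith
      · have := Real.exp_le_exp.2 (neg_le_neg hx.1)
        linarith
  -- Two intermediate radii: the geometric rate holds on the open ball of radius `s'`, strictly
  -- inside the disc of radius `r < 1/2` that carries the Cauchy series.
  obtain ⟨s', hss', hs'⟩ := exists_between hs
  obtain ⟨r, hs'r, hr⟩ := exists_between hs'
  have hr0 : 0 < r := by linarith
  lift r to NNReal using hr0.le
  lift s' to NNReal using (by linarith)
  have hps := (differentiableOn_neg_inv_log hr).hasFPowerSeriesOnBall (by exact_mod_cast hr0)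
  set p := cauchyPowerSeries (fun z => -(Complex.log z)⁻¹) (1 / 2) r
  obtain ⟨ρ, hρ, C, hC, h⟩ := hps.uniform_geometric_approx
    (r' := s') (by exact_mod_cast hs'r)
  refine ⟨C, hC, ρ, hρ, fun N => ?_⟩
  obtain ⟨P, hPd, hP⟩ := exists_polynomial_eq_partialSum p (1 / 2) N
  -- At real points, real parts of the coefficients give the real part of `P`, and `|re w| ≤ ‖w‖`.
  refine ⟨fun m => (P.coeff m).re, fun x hx => ?_⟩
  have hx0 : 0 < x := ha.trans_le hx.1
  have hball : ((Real.exp (-x) : ℂ) - 1 / 2) ∈ Metric.ball (0 : ℂ) s' := by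
    rw [mem_ball_zero_iff]
    have : ((Real.exp (-x) : ℂ) - 1 / 2) = ((Real.exp (-x) - 1 / 2 : ℝ) : ℂ) := by push_cast; ring
    rw [this, Complex.norm_real, Real.norm_eq_abs]
    exact (hsI x hx).trans_lt hss'
  have key := h _ hball N
  rw [← hP, add_sub_cancel, ← Complex.ofReal_log (Real.exp_pos _).le, Real.log_exp] at key
  refine le_trans ?_ key
  refine le_trans (le_of_eq ?_) (Complex.abs_re_le_norm _)
  congr 1
  rw [Complex.sub_re]
  congr 1
  · rw [← Complex.ofReal_inv, ← Complex.ofReal_neg, Complex.ofReal_re]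
    rw [inv_neg, neg_neg, one_div]
  · rcases Nat.eq_zero_or_pos N with rfl | hN
    · have : P = 0 := by
        simpa using hPd
      simp [this]
    · have hPn : P.natDegree < N := by
        rcases eq_or_ne P 0 with rfl | hP0
        · simpa using hN
        · exact (Polynomial.natDegree_lt_iff_degree_lt hP0).2 hPd
      rw [Polynomial.eval_eq_sum_range' hPn,
        Complex.re_sum, Finset.sum_range]
      refine Finset.sum_congr rfl fun m _ => ?_
      rw [← Complex.ofReal_pow, Complex.re_mul_ofReal]

end ExponentialSums

/-! ### Number of terms and canonical rank. -/

section Rank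

/-- The number of terms needed to push a geometric error `C * ρ ^ N` below `ε`. -/
def numTerms (C ρ ε : ℝ) : ℕ := ⌈Real.log (ε / C) / Real.log ρ⌉₊

theorem geometric_le_of_numTerms {C ρ ε : ℝ} (hC : 0 < C) (hρ : ρ ∈ Set.Ioo (0 : ℝ) 1)
    (hε : 0 < ε) : C * ρ ^ numTerms C ρ ε ≤ ε := by
  have hlog : Real.log ρ < 0 := Real.log_neg hρ.1 hρ.2
  have h : ρ ^ numTerms C ρ ε ≤ ε / C := by
    rw [← Real.log_le_log_iff (pow_pos hρ.1 _) (div_pos hε hC), Real.log_pow]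
    have := Nat.le_ceil (Real.log (ε / C) / Real.log ρ)
    rwa [div_le_iff_of_neg hlog] at this
  rw [le_div_iff₀ hC] at h
  linarith

theorem isBigO_numTerms_add_one {C ρ : ℝ} (hC : 0 < C) (hρ : ρ ∈ Set.Ioo (0 : ℝ) 1) :
    (fun ε : ℝ => ((numTerms C ρ ε + 1 : ℕ) : ℝ)) =O[𝓝[>] (0 : ℝ)]
      (fun ε : ℝ => |Real.log ε|) := by
  have hlog : 0 < |Real.log ρ| := abs_pos.2 (Real.log_neg hρ.1 hρ.2).ne
  -- The `2` pays for the ceiling and the extra term, since `|log ε| ≥ 1` for `ε < exp (-1)`.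
  refine IsBigO.of_bound ((1 + |Real.log C|) / |Real.log ρ| + 2) ?_
  filter_upwards [Ioo_mem_nhdsGT (Real.exp_pos (-1))] with ε hε
  have h1 : 1 ≤ |Real.log ε| := by
    have : Real.log ε < -1 := (Real.log_lt_iff_lt_exp hε.1).2 hε.2
    rw [abs_of_neg (by linarith)]
    linarith
  have h2 : (numTerms C ρ ε : ℝ) ≤ |Real.log (ε / C) / Real.log ρ| + 1 :=
    (Nat.ceil_le_ceil (le_abs_self _) |> Nat.cast_le.2).trans
      (Nat.ceil_lt_add_one (abs_nonneg _)).le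
  have h3 : |Real.log (ε / C)| ≤ (1 + |Real.log C|) * |Real.log ε| := by
    rw [Real.log_div hε.1.ne' hC.ne']
    have := abs_sub (Real.log ε) (Real.log C)
    nlinarith [abs_nonneg (Real.log C)]
  have h4 : |Real.log (ε / C) / Real.log ρ| ≤
      (1 + |Real.log C|) / |Real.log ρ| * |Real.log ε| := by
    rw [abs_div, div_mul_eq_mul_div]
    gcongr
  rw [Real.norm_of_nonneg (Nat.cast_nonneg _), Real.norm_of_nonneg (abs_nonneg _)]
  push_cast
  nlinarith

theorem HasCanonicalDecomposition.add_rankOne {n r : ℕ} {T : Fin n → Fin n → Fin n → ℝ}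
    (hT : HasCanonicalDecomposition r T) (x y z : Fin n → ℝ) :
    HasCanonicalDecomposition (r + 1) (fun i j k => T i j k + x i * y j * z k) := by
  obtain ⟨u, v, w, h⟩ := hT
  refine ⟨Fin.snoc u x, Fin.snoc v y, Fin.snoc w z, fun i j k => ?_⟩
  simp [Fin.sum_univ_castSucc, h]

theorem HasCanonicalDecomposition.mono {n r s : ℕ} {T : Fin n → Fin n → Fin n → ℝ}
    (hT : HasCanonicalDecomposition r T) (hrs : r ≤ s) : HasCanonicalDecomposition s T := by
  induction s, hrs using Nat.le_induction with
  | base => exact hT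
  | succ s _ ih => simpa using ih.add_rankOne 0 0 0

/-- A tensor of rank at most `N + 1` which has a prescribed first entry and approximates the other
entries of `1 / g` as well as an exponential sum with `N` terms approximates `1 / x`. -/
theorem exists_canonical_approx {a b δ : ℝ} {N : ℕ} (c : Fin N → ℝ)
    (hc : ∀ x ∈ Set.Icc a (3 * b), |1 / x - ∑ m, c m * Real.exp (-x) ^ (m : ℕ)| ≤ δ)
    {n : ℕ} [NeZero n] {lam : Fin n → ℝ} (hlam : PositivityCondition a lam)
    (hb : ∀ i, lam i ≤ b) (t : ℝ) :
    ∃ T : Fin n → Fin n → Fin n → ℝ, HasCanonicalDecomposition (N + 1) T ∧ T 0 0 0 = t ∧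
      ∀ i j k, ¬(i = 0 ∧ j = 0 ∧ k = 0) → |1 / coreTensor lam i j k - T i j k| ≤ δ := by
  set S : Fin n → Fin n → Fin n → ℝ := fun i j k =>
    ∑ m : Fin N, c m * Real.exp (-coreTensor lam i j k) ^ (m : ℕ) with hS
  have hSd : HasCanonicalDecomposition N S := by
    refine ⟨fun m i => c m * Real.exp (-lam i) ^ (m : ℕ), fun m i => Real.exp (-lam i) ^ (m : ℕ),
      fun m i => Real.exp (-lam i) ^ (m : ℕ), fun i j k => Finset.sum_congr rfl fun m _ => ?_⟩
    rw [coreTensor, neg_add, neg_add, Real.exp_add, Real.exp_add]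
    ring
  -- The correction is supported at the first entry, where `g` may lie outside `[a, 3b]`.
  refine ⟨_, hSd.add_rankOne (Pi.single 0 (t - S 0 0 0)) (Pi.single 0 1) (Pi.single 0 1),
    by simp, fun i j k h => ?_⟩
  have h0 : (Pi.single 0 (t - S 0 0 0) : Fin n → ℝ) i * (Pi.single 0 1 : Fin n → ℝ) j *
      (Pi.single 0 1 : Fin n → ℝ) k = 0 := by
    simp only [Pi.single_apply]
    split_ifs <;> simp_all
  rw [h0, add_zero]
  refine hc _ ⟨hlam i j k h, ?_⟩
  rw [coreTensor]
  linarith [hb i, hb j, hb k]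

end Rank


/-! ### Fourier diagonalization and the spectrum of the 1D Laplacian. -/

section Fourier

variable {n : ℕ}

/-- The entries of the unnormalized Fourier matrix. -/
def fourierChar (j k : Fin n) : ℂ :=
  Complex.exp (-(2 * Real.pi * Complex.I * ((j.val : ℂ) * (k.val : ℂ)) / (n : ℂ)))

/-- The standard primitive `n`-th root of unity. -/
def rootOfUnity (n : ℕ) : ℂ := Complex.exp (2 * Real.pi * Complex.I / n)

theorem isPrimitiveRoot_rootOfUnity [NeZero n] : IsPrimitiveRoot (rootOfUnity n) n :=
  Complex.isPrimitiveRoot_exp n (NeZero.ne n)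

theorem fourierChar_eq_pow (j k : Fin n) :
    fourierChar j k = ((rootOfUnity n)⁻¹ ^ j.val) ^ k.val := by
  rw [fourierChar, rootOfUnity, ← Complex.exp_neg, ← Complex.exp_nat_mul, ← Complex.exp_nat_mul]
  congr 1
  ring

theorem star_fourierChar (j k : Fin n) :
    star (fourierChar j k) = (rootOfUnity n ^ j.val) ^ k.val := by
  rw [fourierChar, rootOfUnity, ← Complex.exp_nat_mul, ← Complex.exp_nat_mul, Complex.star_def,
    ← Complex.exp_conj]
  congr 1
  simp [Complex.conj_ofNat]
  ring

/-- Addition in `Fin n` is modulo `n`, which is harmless for powers of an `n`-th root of unity. -/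
theorem fourierChar_add [NeZero n] (j k l : Fin n) :
    fourierChar j (k + l) = fourierChar j k * fourierChar j l := by
  have h : ((rootOfUnity n)⁻¹ ^ j.val) ^ n = 1 := by
    rw [← pow_mul, mul_comm, pow_mul, inv_pow, isPrimitiveRoot_rootOfUnity.pow_eq_one]
    simp
  simp only [fourierChar_eq_pow]
  rw [← pow_add, Fin.val_add, ← pow_mod_orderOf, Nat.mod_mod_of_dvd _ (orderOf_dvd_of_pow_eq_one h),
    pow_mod_orderOf]

/-- A geometric sum whose ratio has `n`-th power `1`; by primitivity the ratio is `1` only for `j =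
l`. -/
theorem sum_star_fourierChar_mul [NeZero n] (j l : Fin n) :
    ∑ k, star (fourierChar k j) * fourierChar k l = if j = l then (n : ℂ) else 0 := by
  set ω := rootOfUnity n with hω
  have hprim : IsPrimitiveRoot ω n := isPrimitiveRoot_rootOfUnity
  have hω0 : ω ≠ 0 := hprim.ne_zero (NeZero.ne n)
  have hterm : ∀ k : Fin n,
      star (fourierChar k j) * fourierChar k l = (ω ^ j.val * ω⁻¹ ^ l.val) ^ k.val := by
    intro k
    rw [star_fourierChar, fourierChar_eq_pow, mul_pow]
    congr 1 <;> rw [← pow_mul, ← pow_mul, mul_comm]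
  simp only [hterm]
  rw [← Finset.sum_range (fun k => (ω ^ j.val * ω⁻¹ ^ l.val) ^ k)]
  split_ifs with h
  · subst h
    simp [hω0]
  · have hz : ω ^ j.val * ω⁻¹ ^ l.val ≠ 1 := by
      intro hz
      rw [inv_pow, mul_inv_eq_one₀ (pow_ne_zero _ hω0)] at hz
      exact h (Fin.ext (hprim.pow_inj j.isLt l.isLt hz))
    rw [geom_sum_eq hz, mul_pow, ← pow_mul, ← pow_mul, mul_comm j.val, mul_comm l.val, pow_mul,
      pow_mul, inv_pow, hprim.pow_eq_one]
    simp

theorem fourierMatrix_apply (j k : Fin n) :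
    fourierMatrix n j k = ((Real.sqrt n : ℝ) : ℂ)⁻¹ * fourierChar j k := rfl

theorem conjTranspose_fourierMatrix_mul_self [NeZero n] :
    (fourierMatrix n)ᴴ * fourierMatrix n = 1 := by
  ext j l
  have hn : (n : ℂ) ≠ 0 := Nat.cast_ne_zero.2 (NeZero.ne n)
  have hsq : ((Real.sqrt n : ℝ) : ℂ)⁻¹ * ((Real.sqrt n : ℝ) : ℂ)⁻¹ = (n : ℂ)⁻¹ := by
    rw [← mul_inv, ← Complex.ofReal_mul, Real.mul_self_sqrt (Nat.cast_nonneg n),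
      Complex.ofReal_natCast]
  have hterm : ∀ k, (fourierMatrix n)ᴴ j k * fourierMatrix n k l =
      (n : ℂ)⁻¹ * (star (fourierChar k j) * fourierChar k l) := by
    intro k
    rw [Matrix.conjTranspose_apply, fourierMatrix_apply, fourierMatrix_apply, star_mul', ← hsq]
    simp only [Complex.star_def, map_inv₀, Complex.conj_ofReal]
    ring
  rw [Matrix.mul_apply]
  simp only [hterm]
  rw [← Finset.mul_sum, sum_star_fourierChar_mul, Matrix.one_apply]
  split_ifs <;> simp [hn]

theorem fourierMatrix_mul_conjTranspose_self [NeZero n] :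
    fourierMatrix n * (fourierMatrix n)ᴴ = 1 :=
  mul_eq_one_comm.1 conjTranspose_fourierMatrix_mul_self

/-- The discrete Fourier transform diagonalizes circulant matrices. -/
theorem fourierMatrix_mul_circulant [NeZero n] (p : Fin n → ℂ) :
    fourierMatrix n * Matrix.circulant p =
      Matrix.diagonal (fun j => ∑ k, p k * fourierChar j k) * fourierMatrix n := by
  ext j l
  -- The shift `k ↦ k + l` turns the circulant entry `p (k - l)` into `p k`.
  rw [Matrix.diagonal_mul, Matrix.mul_apply, ← Equiv.sum_comp (Equiv.addRight l), Finset.sum_mul]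
  refine Finset.sum_congr rfl fun k _ => ?_
  simp only [Equiv.coe_addRight, fourierMatrix_apply, Matrix.circulant_apply, fourierChar_add,
    add_sub_cancel_right]
  ring

/-- `3 ≤ n` makes the indices `0`, `1`, `n - 1` distinct. -/
theorem stencil_eq [NeZero n] (hn : 3 ≤ n) (k : Fin n) :
    stencil n k = (if k = 0 then 2 else 0) + (if k = ⟨1, by omega⟩ then -1 else 0) +
      (if k = ⟨n - 1, by omega⟩ then -1 else 0) := by
  simp only [stencil, Fin.ext_iff, Fin.val_zero]
  split_ifs <;> first | omega | norm_num

theorem sum_stencil_mul_fourierChar [NeZero n] (hn : 3 ≤ n) (j : Fin n) :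
    ∑ k, (stencil n k : ℂ) * fourierChar j k =
      ((4 * Real.sin (Real.pi * j / n) ^ 2 : ℝ) : ℂ) := by
  have hn0 : (n : ℂ) ≠ 0 := Nat.cast_ne_zero.2 (NeZero.ne n)
  set θ : ℂ := 2 * (Real.pi * j / n) with hθ
  have h0 : fourierChar j 0 = 1 := by simp [fourierChar]
  have h1 : fourierChar j ⟨1, by omega⟩ = Complex.exp (-θ * Complex.I) := by
    rw [fourierChar, hθ]
    congr 1
    push_cast
    ring
  have h2 : fourierChar j ⟨n - 1, by omega⟩ = Complex.exp (θ * Complex.I) := by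
    rw [fourierChar, Complex.exp_eq_exp_iff_exists_int, hθ]
    refine ⟨-(j.val : ℤ), ?_⟩
    have : ((n - 1 : ℕ) : ℂ) = n - 1 := by
      rw [Nat.cast_sub (by omega), Nat.cast_one]
    simp only [this]
    push_cast
    field_simp
    ring
  have hsum : ∑ k, (stencil n k : ℂ) * fourierChar j k =
      2 - Complex.exp (-θ * Complex.I) - Complex.exp (θ * Complex.I) := by
    simp only [stencil_eq hn, Complex.ofReal_add, apply_ite Complex.ofReal, Complex.ofReal_zero,
      Complex.ofReal_neg, Complex.ofReal_one, Complex.ofReal_ofNat, add_mul, Finset.sum_add_distrib, ite_mul, zero_mul, Finset.sum_ite_eq',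
      Finset.mem_univ, if_true, h0, h1, h2]
    ring
  rw [hsum]
  push_cast
  have hcos := Complex.two_cos θ
  have hcos2 := Complex.cos_two_mul (Real.pi * j / n)
  rw [← hθ] at hcos2
  have hsc := Complex.sin_sq_add_cos_sq (Real.pi * j / n)
  -- This is `2 - 2 cos θ = 4 sin² (θ / 2)`.
  linear_combination hcos - 2 * hcos2 - 4 * hsc

theorem laplacianEigenvalue_eq [NeZero n] (hn : 3 ≤ n) (j : Fin n) :
    laplacianEigenvalue n j = 4 * Real.sin (Real.pi * j / n) ^ 2 := by
  have h := congrArg Complex.re (sum_stencil_mul_fourierChar hn j)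
  rwa [Complex.ofReal_re] at h

theorem laplacian1D_eq [NeZero n] (hn : 3 ≤ n) :
    laplacian1D n = fourierDiagonal (laplacianEigenvalue n) := by
  have h := fourierMatrix_mul_circulant fun j : Fin n => (stencil n j : ℂ)
  have h2 : (fun j => ∑ k, (stencil n k : ℂ) * fourierChar j k) =
      fun j => ((laplacianEigenvalue n j : ℝ) : ℂ) := by
    funext j
    rw [sum_stencil_mul_fourierChar hn, laplacianEigenvalue_eq hn]
  rw [h2] at h
  rw [fourierDiagonal, Matrix.mul_assoc, ← h, ← Matrix.mul_assoc,
    conjTranspose_fourierMatrix_mul_self, Matrix.one_mul, laplacian1D]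

theorem laplacianEigenvalue_nonneg [NeZero n] (hn : 3 ≤ n) (j : Fin n) : 0 ≤ laplacianEigenvalue n j := by
  rw [laplacianEigenvalue_eq hn]
  positivity

theorem laplacianEigenvalue_zero [NeZero n] (hn : 3 ≤ n) : laplacianEigenvalue n 0 = 0 := by
  simp [laplacianEigenvalue_eq hn]

theorem laplacianEigenvalue_le_four [NeZero n] (hn : 3 ≤ n) (j : Fin n) : laplacianEigenvalue n j ≤ 4 := by
  rw [laplacianEigenvalue_eq hn]
  linarith [Real.sin_sq_le_one (Real.pi * j / n)]

/-- The angle `π j / n` lies in `[π / n, π - π / n]`; the sine is symmetric about `π / 2` and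
increasing before it. -/
theorem le_laplacianEigenvalue [NeZero n] (hn : 3 ≤ n) {j : Fin n} (hj : j ≠ 0) :
    4 * Real.sin (Real.pi / n) ^ 2 ≤ laplacianEigenvalue n j := by
  rw [laplacianEigenvalue_eq hn]
  have hn0 : (0 : ℝ) < n := Nat.cast_pos.2 (by omega)
  have hj1 : (1 : ℝ) ≤ j.val := by
    exact_mod_cast Nat.one_le_iff_ne_zero.2 fun h => hj (Fin.ext h)
  have hjn : (j.val : ℝ) + 1 ≤ n := by exact_mod_cast j.isLt
  have hpi := Real.pi_pos
  have hn3 : (3 : ℝ) ≤ n := by exact_mod_cast hn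
  have hpn : Real.pi / n ≤ Real.pi / 2 := by gcongr; linarith
  have hpn0 : 0 < Real.pi / n := by positivity
  have hle : Real.pi / n ≤ Real.pi * j / n := by
    gcongr
    nlinarith
  have hle' : Real.pi * j / n ≤ Real.pi - Real.pi / n := by
    rw [le_sub_iff_add_le, ← add_div, div_le_iff₀ hn0]
    nlinarith
  have hs0 : 0 ≤ Real.sin (Real.pi / n) :=
    Real.sin_nonneg_of_nonneg_of_le_pi hpn0.le (by linarith)
  have hs : Real.sin (Real.pi / n) ≤ Real.sin (Real.pi * j / n) := by
    rcases le_total (Real.pi * j / n) (Real.pi / 2) with h | h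
    · exact Real.sin_le_sin_of_le_of_le_pi_div_two (by linarith) h hle
    · rw [← Real.sin_pi_sub (Real.pi * j / n)]
      exact Real.sin_le_sin_of_le_of_le_pi_div_two (by linarith) (by linarith) (by linarith)
  gcongr

theorem positivityCondition_laplacianEigenvalue [NeZero n] (hn : 3 ≤ n) {a : ℝ}
    (ha : a ≤ 4 * Real.sin (Real.pi / n) ^ 2) :
    PositivityCondition a (laplacianEigenvalue n) := by
  intro i j k h
  have hi := laplacianEigenvalue_nonneg hn i
  have hj := laplacianEigenvalue_nonneg hn j
  have hk := laplacianEigenvalue_nonneg hn k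
  rw [coreTensor]
  by_cases h0 : i = 0
  · by_cases h1 : j = 0
    · linarith [le_laplacianEigenvalue hn fun h2 : k = 0 => h ⟨h0, h1, h2⟩]
    · linarith [le_laplacianEigenvalue hn h1]
  · linarith [le_laplacianEigenvalue hn h0]

end Fourier

/-! ### Calculus of 3D Fourier-diagonal matrices. -/

section ThreeDimensional

variable {n : ℕ}

/-- The three-dimensional unitary Fourier matrix. -/
def fourierMatrix3D (n : ℕ) : Matrix (Fin n × Fin n × Fin n) (Fin n × Fin n × Fin n) ℂ :=
  fourierMatrix n ⊗ₖ (fourierMatrix n ⊗ₖ fourierMatrix n)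

/-- The matrix with eigenvalues `d` in the three-dimensional Fourier basis. -/
def fourierDiagonal3D (d : Fin n → Fin n → Fin n → ℝ) :
    Matrix (Fin n × Fin n × Fin n) (Fin n × Fin n × Fin n) ℂ :=
  (fourierMatrix3D n)ᴴ * Matrix.diagonal (fun i => (d i.1 i.2.1 i.2.2 : ℂ)) * fourierMatrix3D n

theorem conjTranspose_fourierMatrix3D_mul_self [NeZero n] :
    (fourierMatrix3D n)ᴴ * fourierMatrix3D n = 1 := by
  simp only [fourierMatrix3D, Matrix.conjTranspose_kronecker, ← Matrix.mul_kronecker_mul,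
    conjTranspose_fourierMatrix_mul_self, Matrix.one_kronecker_one]

theorem fourierMatrix3D_mul_conjTranspose_self [NeZero n] :
    fourierMatrix3D n * (fourierMatrix3D n)ᴴ = 1 :=
  mul_eq_one_comm.1 conjTranspose_fourierMatrix3D_mul_self

theorem fourierDiagonal_kronecker (u v w : Fin n → ℝ) :
    fourierDiagonal u ⊗ₖ (fourierDiagonal v ⊗ₖ fourierDiagonal w) =
      fourierDiagonal3D fun i j k => u i * v j * w k := by
  simp only [fourierDiagonal, fourierDiagonal3D, fourierMatrix3D, Matrix.mul_kronecker_mul,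
    Matrix.conjTranspose_kronecker, Matrix.diagonal_kronecker_diagonal]
  congr 3
  ext i
  push_cast
  ring

theorem fourierDiagonal_one [NeZero n] : fourierDiagonal (1 : Fin n → ℝ) = 1 := by
  simp [fourierDiagonal, conjTranspose_fourierMatrix_mul_self]

theorem fourierDiagonal3D_add (d e : Fin n → Fin n → Fin n → ℝ) :
    fourierDiagonal3D d + fourierDiagonal3D e = fourierDiagonal3D (d + e) := by
  simp only [fourierDiagonal3D, ← Matrix.add_mul, ← Matrix.mul_add, Matrix.diagonal_add]
  simp

theorem fourierDiagonal3D_sub (d e : Fin n → Fin n → Fin n → ℝ) :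
    fourierDiagonal3D d - fourierDiagonal3D e = fourierDiagonal3D (d - e) := by
  simp only [fourierDiagonal3D, ← Matrix.sub_mul, ← Matrix.mul_sub, Matrix.diagonal_sub]
  simp

theorem fourierDiagonal3D_sum {r : ℕ} (d : Fin r → Fin n → Fin n → Fin n → ℝ) :
    ∑ m, fourierDiagonal3D (d m) = fourierDiagonal3D (fun i j k => ∑ m, d m i j k) := by
  simp only [fourierDiagonal3D, ← Matrix.sum_mul, ← Matrix.mul_sum]
  congr 2
  ext i j
  rw [Matrix.sum_apply]
  by_cases h : i = j <;> simp [h]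

theorem fourierDiagonal3D_mul [NeZero n] (d e : Fin n → Fin n → Fin n → ℝ) :
    fourierDiagonal3D d * fourierDiagonal3D e = fourierDiagonal3D (d * e) := by
  have h : ∀ D E : Matrix (Fin n × Fin n × Fin n) (Fin n × Fin n × Fin n) ℂ,
      (fourierMatrix3D n)ᴴ * D * fourierMatrix3D n *
        ((fourierMatrix3D n)ᴴ * E * fourierMatrix3D n) =
      (fourierMatrix3D n)ᴴ * (D * E) * fourierMatrix3D n := by
    intro D E
    calc _ = (fourierMatrix3D n)ᴴ * D * (fourierMatrix3D n * (fourierMatrix3D n)ᴴ) * E *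
          fourierMatrix3D n := by simp only [Matrix.mul_assoc]
      _ = _ := by
        rw [fourierMatrix3D_mul_conjTranspose_self, Matrix.mul_one]
        simp only [Matrix.mul_assoc]
  simp only [fourierDiagonal3D, h, Matrix.diagonal_mul_diagonal]
  simp

theorem conjTranspose_fourierDiagonal3D (d : Fin n → Fin n → Fin n → ℝ) :
    (fourierDiagonal3D d)ᴴ = fourierDiagonal3D d := by
  have h : star (fun i : Fin n × Fin n × Fin n => (d i.1 i.2.1 i.2.2 : ℂ)) =
      fun i => (d i.1 i.2.1 i.2.2 : ℂ) := by
    ext i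
    simp
  rw [fourierDiagonal3D, Matrix.conjTranspose_mul, Matrix.conjTranspose_mul,
    Matrix.conjTranspose_conjTranspose, Matrix.diagonal_conjTranspose, h, Matrix.mul_assoc]

theorem norm_fourierDiagonal3D_le [NeZero n] {d : Fin n → Fin n → Fin n → ℝ} {δ : ℝ}
    (hd : ∀ i j k, |d i j k| ≤ δ) : ‖fourierDiagonal3D d‖ ≤ δ := by
  have hδ : 0 ≤ δ := (abs_nonneg _).trans (hd 0 0 0)
  have hU : fourierMatrix3D n ∈ unitary (Matrix (Fin n × Fin n × Fin n)
      (Fin n × Fin n × Fin n) ℂ) :=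
    ⟨conjTranspose_fourierMatrix3D_mul_self, fourierMatrix3D_mul_conjTranspose_self⟩
  rw [fourierDiagonal3D, ← Matrix.star_eq_conjTranspose, CStarRing.norm_mul_mem_unitary _ hU,
    CStarRing.norm_mem_unitary_mul _ (Unitary.star_mem hU), Matrix.l2_opNorm_diagonal,
    pi_norm_le_iff_of_nonneg hδ]
  intro i
  rw [Complex.norm_real]
  exact hd _ _ _

theorem laplacian3D_eq [NeZero n] (hn : 3 ≤ n) :
    laplacian3D n = fourierDiagonal3D (coreTensor (laplacianEigenvalue n)) := by
  rw [laplacian3D, laplacian1D_eq hn, ← fourierDiagonal_one]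
  simp only [fourierDiagonal_kronecker, fourierDiagonal3D_add]
  congr 1
  ext i j k
  simp [coreTensor]

/-- In the Fourier basis the first two Penrose equations are scalar identities, as the core tensor
vanishes only at the first index. The other two hold because real Fourier-diagonal matrices are
Hermitian. -/
theorem isPseudoInverse_laplacian3D [NeZero n] (hn : 3 ≤ n) :
    IsPseudoInverse (laplacian3D n)
      (fourierDiagonal3D (pinvCoreTensor (laplacianEigenvalue n))) := by
  have hsin : 0 < Real.sin (Real.pi / n) := by
    have hn1 : (1 : ℝ) < n := by exact_mod_cast (show 1 < n by omega)
    exact Real.sin_pos_of_pos_of_lt_pi (by positivity) (div_lt_self Real.pi_pos hn1)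
  have hpos := positivityCondition_laplacianEigenvalue hn le_rfl
  have hcore : ∀ i j k : Fin n, (i = 0 ∧ j = 0 ∧ k = 0) ∧
      coreTensor (laplacianEigenvalue n) i j k = 0 ∧
      pinvCoreTensor (laplacianEigenvalue n) i j k = 0 ∨
      coreTensor (laplacianEigenvalue n) i j k *
        pinvCoreTensor (laplacianEigenvalue n) i j k = 1 := by
    intro i j k
    by_cases h : i = 0 ∧ j = 0 ∧ k = 0
    · refine Or.inl ⟨h, ?_, if_pos h⟩
      obtain ⟨rfl, rfl, rfl⟩ := h
      simp [coreTensor, laplacianEigenvalue_zero hn]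
    · right
      have : 0 < coreTensor (laplacianEigenvalue n) i j k :=
        lt_of_lt_of_le (by positivity) (hpos i j k h)
      rw [pinvCoreTensor, if_neg h, mul_one_div_cancel this.ne']
  rw [laplacian3D_eq hn]
  refine ⟨?_, ?_, ?_, ?_⟩
  · rw [fourierDiagonal3D_mul, fourierDiagonal3D_mul]
    congr 1
    ext i j k
    simp only [Pi.mul_apply]
    rcases hcore i j k with ⟨-, h, -⟩ | h <;> simp [h]
  · rw [fourierDiagonal3D_mul, fourierDiagonal3D_mul]
    congr 1
    ext i j k
    simp only [Pi.mul_apply]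
    rcases hcore i j k with ⟨-, -, h⟩ | h
    · simp [h]
    · rw [mul_assoc, h, mul_one]
  · rw [fourierDiagonal3D_mul, conjTranspose_fourierDiagonal3D]
  · rw [fourierDiagonal3D_mul, conjTranspose_fourierDiagonal3D]

end ThreeDimensional

end PeriodicLaplacian

end

/-! ### The main theorem. -/

/-- The norm in the last part is the spectral norm (the operator norm induced by the Euclidean
norm). The function `R` depends on `a` and `b` only. -/
theorem mainTheorem1 (a b : ℝ) (ha : 0 < a) :
    ∃ R : ℝ → ℕ,
      (fun ε : ℝ => (R ε : ℝ)) =O[𝓝[>] (0 : ℝ)] (fun ε : ℝ => |Real.log ε|) ∧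
      ∀ ε : ℝ, 0 < ε →
        (∀ (n : ℕ) [NeZero n] (lam : Fin n → ℝ),
          PeriodicLaplacian.PositivityCondition a lam → (∀ i, lam i ≤ b) →
          (∃ T : Fin n → Fin n → Fin n → ℝ,
            PeriodicLaplacian.HasCanonicalDecomposition (R ε) T ∧
            ∀ i j k, PeriodicLaplacian.coreTensor lam i j k ≠ 0 →
              |1 / PeriodicLaplacian.coreTensor lam i j k - T i j k| ≤ ε) ∧
          (∃ T : Fin n → Fin n → Fin n → ℝ,
            PeriodicLaplacian.HasCanonicalDecomposition (2 * R ε + 1) T ∧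
            ∀ i j k, |PeriodicLaplacian.pinvCoreTensor lam i j k - T i j k| ≤ 2 * ε)) ∧
        (∀ (n : ℕ) [NeZero n], 3 ≤ n → a ≤ 4 * Real.sin (Real.pi / n) ^ 2 → 4 ≤ b →
          PeriodicLaplacian.PositivityCondition a (PeriodicLaplacian.laplacianEigenvalue n) ∧
          ∃ X : Matrix (Fin n × Fin n × Fin n) (Fin n × Fin n × Fin n) ℂ,
            PeriodicLaplacian.IsPseudoInverse (PeriodicLaplacian.laplacian3D n) X ∧
            ∃ u v w : Fin (2 * R ε + 1) → Fin n → ℝ,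
              ‖X - ∑ m, PeriodicLaplacian.fourierDiagonal (u m) ⊗ₖ
                (PeriodicLaplacian.fourierDiagonal (v m) ⊗ₖ
                  PeriodicLaplacian.fourierDiagonal (w m))‖ ≤ 2 * ε) := by
  obtain ⟨C, hC, ρ, hρ, happrox⟩ := PeriodicLaplacian.exists_expSum_approx_inv (B := 3 * b) ha
  have hmain : ∀ ε : ℝ, 0 < ε → ∀ (n : ℕ) [NeZero n] (lam : Fin n → ℝ),
      PeriodicLaplacian.PositivityCondition a lam → (∀ i, lam i ≤ b) → ∀ t : ℝ,
      ∃ T : Fin n → Fin n → Fin n → ℝ,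
        PeriodicLaplacian.HasCanonicalDecomposition (PeriodicLaplacian.numTerms C ρ ε + 1) T ∧
        T 0 0 0 = t ∧ ∀ i j k, ¬(i = 0 ∧ j = 0 ∧ k = 0) →
          |1 / PeriodicLaplacian.coreTensor lam i j k - T i j k| ≤ ε := by
    intro ε hε n _ lam hlam hb t
    obtain ⟨c, hc⟩ := happrox (PeriodicLaplacian.numTerms C ρ ε)
    exact PeriodicLaplacian.exists_canonical_approx c (fun x hx => (hc x hx).trans
      (PeriodicLaplacian.geometric_le_of_numTerms hC hρ hε)) hlam hb t
  have hpinv : ∀ ε : ℝ, 0 < ε → ∀ (n : ℕ) [NeZero n] (lam : Fin n → ℝ),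
      PeriodicLaplacian.PositivityCondition a lam → (∀ i, lam i ≤ b) →
      ∃ T : Fin n → Fin n → Fin n → ℝ, PeriodicLaplacian.HasCanonicalDecomposition
          (2 * (PeriodicLaplacian.numTerms C ρ ε + 1) + 1) T ∧
        ∀ i j k, |PeriodicLaplacian.pinvCoreTensor lam i j k - T i j k| ≤ 2 * ε := by
    intro ε hε n _ lam hlam hb
    -- Prescribing the first entry `0` already gives error `ε` with `numTerms C ρ ε + 1` terms; the
    -- doubled bounds are slack.
    obtain ⟨T, hT, hT0, hT1⟩ := hmain ε hε n lam hlam hb 0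
    refine ⟨T, hT.mono (by omega), fun i j k => ?_⟩
    by_cases h : i = 0 ∧ j = 0 ∧ k = 0
    · rw [PeriodicLaplacian.pinvCoreTensor, if_pos h, h.1, h.2.1, h.2.2, hT0, sub_zero, abs_zero]
      positivity
    · rw [PeriodicLaplacian.pinvCoreTensor, if_neg h]
      linarith [hT1 i j k h]
  refine ⟨fun ε => PeriodicLaplacian.numTerms C ρ ε + 1,
    PeriodicLaplacian.isBigO_numTerms_add_one hC hρ, fun ε hε => ⟨?_, ?_⟩⟩
  · intro n _ lam hlam hb
    refine ⟨?_, hpinv ε hε n lam hlam hb⟩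
    -- The first entry is matched exactly, whatever the sign of `g` there.
    obtain ⟨T, hT, hT0, hT1⟩ := hmain ε hε n lam hlam hb
      (1 / PeriodicLaplacian.coreTensor lam 0 0 0)
    refine ⟨T, hT, fun i j k _ => ?_⟩
    by_cases h : i = 0 ∧ j = 0 ∧ k = 0
    · rw [h.1, h.2.1, h.2.2, hT0, sub_self, abs_zero]
      exact hε.le
    · exact hT1 i j k h
  · intro n _ hn hsin hb
    have hpos := PeriodicLaplacian.positivityCondition_laplacianEigenvalue hn hsin
    refine ⟨hpos, _, PeriodicLaplacian.isPseudoInverse_laplacian3D hn, ?_⟩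
    obtain ⟨T, ⟨u, v, w, huvw⟩, hT⟩ := hpinv ε hε n _ hpos
      fun i => (PeriodicLaplacian.laplacianEigenvalue_le_four hn i).trans hb
    refine ⟨u, v, w, ?_⟩
    simp only [PeriodicLaplacian.fourierDiagonal_kronecker,
      PeriodicLaplacian.fourierDiagonal3D_sum, PeriodicLaplacian.fourierDiagonal3D_sub]
    refine PeriodicLaplacian.norm_fourierDiagonal3D_le fun i j k => ?_
    rw [Pi.sub_apply, Pi.sub_apply, Pi.sub_apply, ← huvw]
    exact hT i j k
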